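/- Let $R$ be an associative ring with $1$ and $M$ a nonzero (unital) right $R$-module. For $n\ge 0$, write elements of $M^n$ as rows and elements of the right $R$-module $R^n$ as columns, so that $ax=\sum_i a_ix_i\in M$ is defined for $a\in M^n$, $x\in R^n$. For $S\subseteq R^n$ put $$\mathrm{ann}_{M^n}(S)=\{a\in M^n\mid as=0\text{ for all }s\in S\},\qquad \mathrm{cl}_{R^n}(S)=\{x\in R^n\mid \mathrm{ann}_{M^n}(\{x\})\supseteq \mathrm{ann}_{M^n}(S)\},$$ and for a matrix $A$ over $R$ with $n$ rows let $\mathrm{ann}_{M^n}(A)$ be the annihilator in $M^n$ of the set of columns of $A$. Then: (a) For every $n\ge 0$, $\mathrm{cl}_{R^n}$ is a closure operator on $R^n$ (that is, $S\subseteq T\Rightarrow \mathrm{cl}_{R^n}(S)\subseteq\mathrm{cl}_{R^n}(T)$, $S\subseteq \mathrm{cl}_{R^n}(S)$, and $\mathrm{cl}_{R^n}(\mathrm{cl}_{R^n}(S))=\mathrm{cl}_{R^n}(S)$), and its closed subsets are $R$-submodules of $R^n$. For every $n>0$, $\mathrm{cl}_{R^n}(\emptyset)$ is a proper submodule of $R^n$.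 For all $m,n\ge 0$, every homomorphism of right $R$-modules $h:R^m\to R^n$ and every $\mathrm{cl}_{R^n}$-closed submodule $A\subseteq R^n$, the submodule $h^{-1}(A)\subseteq R^m$ is $\mathrm{cl}_{R^m}$-closed. (b) For each $n\ge 0$, the exchange property (E) for all $S\subseteq R^n$ and $t,u\in R^n$, if $u\notin \mathrm{cl}_{R^n}(S)$ but $u\in \mathrm{cl}_{R^n}(S\cup\{t\})$, then $t\in \mathrm{cl}_{R^n}(S\cup\{u\})$ is equivalent to its restriction to sets $S$ of cardinality $<n$, and to each of the following: (1) there do not exist a subset $S\subseteq R^n$ and elements $u,t\in R^n$ such that $\mathrm{ann}_{M^n}(S)\supsetneq \mathrm{ann}_{M^n}(S\cup\{u\})\supsetneq \mathrm{ann}_{M^n}(S\cup\{t\})$; (2) there do not exist an $n\times(n-1)$ matrix $A$ over $R$ and $n\times n$ matrices $B,C$ over $R$, each obtained by adding a single column to $A$, such that $\mathrm{ann}_{M^n}(A)\supsetneq \mathrm{ann}_{M^n}(B)\supsetneq \mathrm{ann}_{M^n}(C)$ (a condition regarded as vacuously true if $n=0$); (3) there do not exist $n\times n$ matrices $A,B,C$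 over $R$ which all agree except in one column, such that $\mathrm{ann}_{M^n}(A)\supsetneq \mathrm{ann}_{M^n}(B)\supsetneq \mathrm{ann}_{M^n}(C)$. (c) If moreover $M$ is faithful and satisfies (1) for all $n\ge 0$, or equivalently (2) for all $n\ge 0$, or equivalently (3) for all $n\ge 0$, then $R$ is embeddable in a division ring, i.e. there is an injective unital ring homomorphism from $R$ to a division ring. -/

import Mathlib

namespace ModuleClosure

/-- `c`, a map from subsets of `X` to subsets of `X`, is a closure operator on `X`. -/
structure IsClosureOp {X : Type*} (c : Set X → Set X) : Prop where
  mono : ∀ S T : Set X, S ⊆ T → c S ⊆ c T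
  subset : ∀ S : Set X, S ⊆ c S
  idem : ∀ S : Set X, c (c S) = c S

section Families

/-! Right `R`-modules are modules over `Rᵐᵒᵖ`; the right module `R^n` is `Fin n → R`. -/

variable {R : Type*} [Ring R]

/-- `c` is a closure operator on `R^n` whose closed subsets are right `R`-submodules. -/
structure IsSubmoduleClosure {n : ℕ} (c : Set (Fin n → R) → Set (Fin n → R)) : Prop where
  isClosureOp : IsClosureOp c
  closed_submodule : ∀ S : Set (Fin n → R), c S = S →
    ∃ N : Submodule Rᵐᵒᵖ (Fin n → R), (N : Set (Fin n → R)) = S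

/-- For all `n > 0`, the closure of the empty set is a proper submodule of `R^n`. -/
def IsProper (c : ∀ n : ℕ, Set (Fin n → R) → Set (Fin n → R)) : Prop :=
  ∀ n : ℕ, 0 < n →
    ∃ N : Submodule Rᵐᵒᵖ (Fin n → R), (N : Set (Fin n → R)) = c n ∅ ∧ N ≠ ⊤

/-- Inverse images of closed submodules under right module homomorphisms `R^m → R^n` are closed. -/
def IsCoherent (c : ∀ n : ℕ, Set (Fin n → R) → Set (Fin n → R)) : Prop :=
  ∀ (m n : ℕ) (h : (Fin m → R) →ₗ[Rᵐᵒᵖ] (Fin n → R)) (A : Submodule Rᵐᵒᵖ (Fin n → R)),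
    c n (A : Set (Fin n → R)) = A →
      c m (A.comap h : Set (Fin m → R)) = A.comap h

/-- The exchange property. -/
def Exchange {X : Type*} (c : Set X → Set X) : Prop :=
  ∀ (S : Set X) (t u : X), u ∉ c S → u ∈ c (S ∪ {t}) → t ∈ c (S ∪ {u})

/-- The exchange property restricted to sets `S` of cardinality less than `n`. -/
def ExchangeBelow {X : Type*} (n : ℕ) (c : Set X → Set X) : Prop :=
  ∀ (S : Set X) (t u : X), S.encard < n → u ∉ c S → u ∈ c (S ∪ {t}) → t ∈ c (S ∪ {u})

end Families

section Annihilators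

variable {R : Type*} [Ring R] (M : Type*) [AddCommGroup M] [Module Rᵐᵒᵖ M] {n : ℕ}

/-- The product `a x = ∑ i, a_i x_i ∈ M` of a row `a ∈ M^n` and a column `x ∈ R^n`. -/
def rowMul {M : Type*} [AddCommGroup M] [Module Rᵐᵒᵖ M]
    (a : Fin n → M) (x : Fin n → R) : M :=
  ∑ i, MulOpposite.op (x i) • a i

/-- `ann_{M^n}(S)`, the set of rows `a ∈ M^n` annihilated by every column in `S`. -/
def ann (S : Set (Fin n → R)) : Set (Fin n → M) :=
  {a | ∀ s ∈ S, rowMul a s = 0}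

/-- The annihilator in `M^n` of the set of columns of a matrix with `n` rows. -/
def annMatrix {m : ℕ} (A : Matrix (Fin n) (Fin m) R) : Set (Fin n → M) :=
  ann M (Set.range A.col)

/-- `cl_{R^n}(S) = {x ∈ R^n | ann_{M^n}(x) ⊇ ann_{M^n}(S)}`. -/
def cl (n : ℕ) (S : Set (Fin n → R)) : Set (Fin n → R) :=
  {x | ann M S ⊆ ann M {x}}

variable (R) (n)

/-- No `S ⊆ R^n` and `u, t ∈ R^n` have `ann(S) ⊋ ann(S ∪ {u}) ⊋ ann(S ∪ {t})`. -/
def NoSetChain : Prop :=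
  ¬ ∃ (S : Set (Fin n → R)) (u t : Fin n → R),
    ann M (S ∪ {u}) ⊂ ann M S ∧ ann M (S ∪ {t}) ⊂ ann M (S ∪ {u})

/-- There are no `n × (n-1)` matrix `A` and `n × n` matrices `B`, `C`, each obtained by
adding a single column to `A`, with `ann(A) ⊋ ann(B) ⊋ ann(C)`.
(Here `m = n - 1`; nothing is asserted if `n = 0`.) -/
def NoAddColumnChain : Prop :=
  ¬ ∃ (m : ℕ) (e : m + 1 = n) (A : Matrix (Fin n) (Fin m) R) (B C : Matrix (Fin n) (Fin n) R),
    (∃ j : Fin (m + 1), B.submatrix id (Fin.cast e ∘ j.succAbove) = A) ∧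
    (∃ j : Fin (m + 1), C.submatrix id (Fin.cast e ∘ j.succAbove) = A) ∧
    annMatrix M B ⊂ annMatrix M A ∧ annMatrix M C ⊂ annMatrix M B

/-- No `n × n` matrices `A`, `B`, `C` which all agree except in one column have
`ann(A) ⊋ ann(B) ⊋ ann(C)`. -/
def NoChangeColumnChain : Prop :=
  ¬ ∃ A B C : Matrix (Fin n) (Fin n) R,
    (∃ j : Fin n, ∀ k : Fin n, k ≠ j → A.col k = B.col k ∧ B.col k = C.col k) ∧
    annMatrix M B ⊂ annMatrix M A ∧ annMatrix M C ⊂ annMatrix M B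

end Annihilators

/-- `R` embeds (by a unital ring homomorphism) in a division ring. -/
def EmbedsInDivisionRing.{u} (R : Type u) [Ring R] : Prop :=
  ∃ (D : Type u) (_ : DivisionRing D) (f : R →+* D), Function.Injective f

end ModuleClosure

namespace ModuleClosure

/-! ### Exchange in finitely spanned closure systems -/

section ClosureOperators

variable {X : Type*} {c : Set X → Set X}

/-! Rows over `M` are the homomorphisms `R^n → M`, so `cl` consists of the points killed by every
homomorphism killing `S`, and (a) is formal. A failure of exchange is exactly a chain of
annihilators. As the standard basis spans, Steinitz replacement reduces exchange to sets of fewer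
than `n` elements (`IsClosureOp.exchange_of_exchangeBelow`), which become matrices after padding
with zero columns.

For (c), exchange passes to all finitely generated modules (`homExchange_of_exchange`). It makes
every nonzero element of a pointed module an equally good point, makes pointed maps injective, and
lets pointed modules be amalgamated. In their direct limit an endomorphism is determined by its
value at the common point (`PointedLimit.hom_eq_zero`), and changing the point of the stages carries
any nonzero element to that point (`PointedLimit.exists_hom_eq_point`). Hence the endomorphisms form
a division ring, in which `r` acts by sending the point to its multiple by `r`. Faithfulness makes
`R`, pointed by `1`, a stage of the limit, whence injectivity. -/

theorem IsClosureOp.closure_subset (hc : IsClosureOp c) {S T : Set X} (h : S ⊆ c T) :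
    c S ⊆ c T :=
  hc.idem T ▸ hc.mono _ _ h

theorem Exchange.exchangeBelow (h : Exchange c) (n : ℕ) : ExchangeBelow n c :=
  fun S t u _ => h S t u

/-- If `s ∉ c I` and `I ∪ J` spans, some element of `J` can be replaced by `s`. -/
theorem IsClosureOp.exists_replace (hc : IsClosureOp c) {n : ℕ} (hx : ExchangeBelow n c)
    [DecidableEq X] {I J : Finset X} (hcard : I.card + J.card ≤ n)
    (hspan : c (I ∪ J : Set X) = Set.univ) {s : X} (hs : s ∉ c I) :
    ∃ e ∈ J, c ((insert s I : Finset X) ∪ (J.erase e : Finset X) : Set X) = Set.univ := by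
  classical
  -- By maximality of `K`, adding any further `e ∈ J` captures `s`, so exchange recovers `e` from
  -- `s`.
  obtain ⟨K, hK, hmax⟩ := Finset.exists_max_image
    (J.powerset.filter fun K : Finset X => s ∉ c (I ∪ K : Set X)) Finset.card
    ⟨∅, by simpa using hs⟩
  rw [Finset.mem_filter, Finset.mem_powerset] at hK
  have hne : K ≠ J := by
    rintro rfl
    exact hK.2 (hspan ▸ Set.mem_univ s)
  obtain ⟨e, heJ, heK⟩ := Finset.exists_of_ssubset (lt_of_le_of_ne hK.1 hne)
  have hse : s ∈ c ((I ∪ K : Set X) ∪ {e}) := by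
    by_contra hcon
    have := hmax (insert e K) (by
      rw [Finset.mem_filter, Finset.mem_powerset]
      refine ⟨Finset.insert_subset heJ hK.1, ?_⟩
      convert hcon using 2
      ext; simp)
    rw [Finset.card_insert_of_notMem heK] at this
    omega
  have hlt : (I ∪ K : Set X).encard < n := by
    rw [← Finset.coe_union, Set.encard_coe_eq_coe_finsetCard]
    have h1 := Finset.card_union_le I K
    have h2 := Finset.card_lt_card (lt_of_le_of_ne hK.1 hne)
    exact_mod_cast (by omega : (I ∪ K).card < n)
  have he := hx _ e s hlt hK.2 hse
  refine ⟨e, heJ, Set.eq_univ_of_univ_subset (hspan ▸ hc.closure_subset ?_)⟩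
  intro x hxm
  by_cases hxe : x = e
  · subst hxe
    refine hc.mono _ _ ?_ he
    rintro y ((hy | hy) | hy)
    · simp_all
    · have : y ≠ x := fun h => heK (h ▸ hy)
      have := hK.1 hy
      simp_all
    · simp_all
  · apply hc.subset
    simp_all
    tauto

/-- A set spanned by `n` elements together with exchange over sets of fewer than `n` elements
satisfies the full exchange property. -/
theorem IsClosureOp.exchange_of_exchangeBelow (hc : IsClosureOp c) {n : ℕ}
    (hx : ExchangeBelow n c) {E : Finset X} (hE : E.card ≤ n) (hspan : c E = Set.univ) :
    Exchange c := by
  classical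
  intro S t u huS hut
  -- `I` grows inside `S` at the expense of `J`. While `J` is nonempty, `I` has fewer than `n`
  -- elements, so restricted exchange applies over `I` once `S ⊆ c I`.
  suffices H : ∀ (k : ℕ) (I J : Finset X), J.card = k → (I : Set X) ⊆ S → I.card + J.card ≤ n →
      c (I ∪ J : Set X) = Set.univ → t ∈ c (S ∪ {u}) from
    H E.card ∅ E rfl (by simp) (by simpa using hE) (by simpa using hspan)
  intro k
  induction k with
  | zero =>
    intro I J hJ hIS _ hsp
    rw [Finset.card_eq_zero] at hJ
    subst hJ
    refine absurd (hc.mono _ _ hIS ?_) huS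
    simp only [Finset.coe_empty, Set.union_empty] at hsp
    exact hsp ▸ Set.mem_univ u
  | succ k ih =>
    intro I J hJ hIS hcard hsp
    by_cases hSI : S ⊆ c I
    · have h1 : (I : Set X).encard < n := by
        rw [Set.encard_coe_eq_coe_finsetCard]
        exact_mod_cast (by omega : I.card < n)
      have h2 : u ∉ c I := fun h => huS (hc.mono _ _ hIS h)
      have h3 : u ∈ c (I ∪ {t}) := by
        refine hc.closure_subset (Set.union_subset ?_ ?_) hut
        · exact hSI.trans (hc.mono _ _ Set.subset_union_left)
        · exact Set.subset_union_right.trans (hc.subset _)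
      exact hc.mono _ _ (Set.union_subset_union_left _ hIS) (hx _ t u h1 h2 h3)
    · obtain ⟨s, hsS, hsI⟩ := Set.not_subset.1 hSI
      obtain ⟨e, heJ, hsp'⟩ := hc.exists_replace hx hcard hsp hsI
      have h1 := Finset.card_erase_of_mem heJ
      have h2 := Finset.card_insert_le s I
      refine ih (insert s I) (J.erase e) (by omega) ?_ (by omega) hsp'
      rw [Finset.coe_insert]
      exact Set.insert_subset hsS hIS

end ClosureOperators

/-! ### Columns of matrices -/

section Columns

variable {R : Type*} {n : ℕ}

theorem range_col_eq_union {m : ℕ} (e : m + 1 = n) (B : Matrix (Fin n) (Fin n) R)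
    (j : Fin (m + 1)) :
    Set.range B.col = Set.range (B.submatrix id (Fin.cast e ∘ j.succAbove)).col ∪
      {B.col (Fin.cast e j)} := by
  subst e
  ext x
  simp only [Set.mem_range, Set.union_singleton, Set.mem_insert_iff, Fin.exists_iff_succAbove j]
  exact or_congr eq_comm Iff.rfl

/-- The matrix with first column `x` and remaining columns those of `A`. -/
def consCol {m : ℕ} (x : Fin n → R) (A : Matrix (Fin n) (Fin m) R) :
    Matrix (Fin n) (Fin (m + 1)) R :=
  fun i => Fin.cons (x i) (A i)

theorem range_col_consCol {m : ℕ} (x : Fin n → R) (A : Matrix (Fin n) (Fin m) R) :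
    Set.range (consCol x A).col = Set.range A.col ∪ {x} := by
  ext y
  simp only [Set.mem_range, Fin.exists_fin_succ, Set.union_singleton, Set.mem_insert_iff]
  exact or_congr eq_comm Iff.rfl

end Columns

/-! ### Closures defined by annihilators -/

section AnnihilatorClosure

variable {R : Type*} [Ring R] {M : Type*} [AddCommGroup M] [Module Rᵐᵒᵖ M] {n : ℕ}

/-- Left multiplication by a row, as a homomorphism of right modules. -/
def rowMulHom (a : Fin n → M) : (Fin n → R) →ₗ[Rᵐᵒᵖ] M where
  toFun := rowMul a
  map_add' x y := by simp [rowMul, add_smul, Finset.sum_add_distrib]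
  map_smul' r x := by simp [rowMul, Finset.smul_sum, mul_smul]

@[simp]
theorem rowMulHom_apply (a : Fin n → M) (x : Fin n → R) : rowMulHom a x = rowMul a x := rfl

theorem rowMul_single (a : Fin n → M) (i : Fin n) (r : R) :
    rowMul a (Pi.single i r) = MulOpposite.op r • a i := by
  rw [rowMul, Finset.sum_eq_single i]
  · simp
  · intro j _ hj
    simp [hj]
  · simp

@[simp]
theorem rowMul_zero (a : Fin n → M) : rowMul a (0 : Fin n → R) = 0 :=
  map_zero (rowMulHom a)

/-- Every homomorphism of right modules `R^n → M` is left multiplication by a row. -/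
theorem rowMul_apply_single (f : (Fin n → R) →ₗ[Rᵐᵒᵖ] M) (x : Fin n → R) :
    rowMul (fun i => f (Pi.single i 1)) x = f x := by
  have : x = ∑ i, MulOpposite.op (x i) • (Pi.single i 1 : Fin n → R) := by
    ext j
    simp [Finset.sum_apply, Pi.single_apply]
  conv_rhs => rw [this]
  simp [rowMul]

theorem ann_union (S T : Set (Fin n → R)) : ann M (S ∪ T) = ann M S ∩ ann M T := by
  ext a
  simp [ann, or_imp, forall_and]

theorem ann_insert_zero (S : Set (Fin n → R)) : ann M (insert 0 S) = ann M S := by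
  ext a
  simp [ann]

theorem ann_anti {S T : Set (Fin n → R)} (h : S ⊆ T) : ann M T ⊆ ann M S :=
  fun _ ha s hs => ha s (h hs)

theorem mem_cl {S : Set (Fin n → R)} {x : Fin n → R} :
    x ∈ cl M n S ↔ ∀ a ∈ ann M S, rowMul a x = 0 := by
  simp [cl, Set.subset_def, ann]

theorem mem_cl_iff_hom {S : Set (Fin n → R)} {x : Fin n → R} :
    x ∈ cl M n S ↔ ∀ f : (Fin n → R) →ₗ[Rᵐᵒᵖ] M, (∀ s ∈ S, f s = 0) → f x = 0 := by
  rw [mem_cl]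
  constructor
  · intro h f hf
    have := h (fun i => f (Pi.single i 1)) fun s hs => by rw [rowMul_apply_single, hf s hs]
    rwa [rowMul_apply_single] at this
  · intro h a ha
    exact h (rowMulHom a) ha

theorem isClosureOp_cl : IsClosureOp (cl (R := R) M n) where
  mono _ _ h _ hx := (ann_anti h).trans hx
  subset _ s hs := mem_cl.2 fun _ ha => ha s hs
  idem S := by
    refine Set.Subset.antisymm (fun x hx => mem_cl.2 fun a ha => ?_)
      (fun x hx => mem_cl.2 fun a ha => ha x hx)
    exact mem_cl.1 hx a fun s hs => mem_cl.1 hs a ha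

variable (M) in
/-- The closure of a set, as a submodule. -/
def clSubmodule (S : Set (Fin n → R)) : Submodule Rᵐᵒᵖ (Fin n → R) where
  carrier := cl M n S
  add_mem' hx hy := mem_cl.2 fun a ha => by
    rw [← rowMulHom_apply, map_add, rowMulHom_apply, rowMulHom_apply, mem_cl.1 hx a ha,
      mem_cl.1 hy a ha, add_zero]
  zero_mem' := mem_cl.2 fun a _ => rowMul_zero a
  smul_mem' r x hx := mem_cl.2 fun a ha => by
    rw [← rowMulHom_apply, map_smul, rowMulHom_apply, mem_cl.1 hx a ha, smul_zero]

theorem isSubmoduleClosure_cl : IsSubmoduleClosure (cl (R := R) M n) where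
  isClosureOp := isClosureOp_cl
  closed_submodule S hS := ⟨clSubmodule M S, hS⟩

theorem isProper_cl [Nontrivial M] : IsProper (R := R) (cl M) := by
  intro n hn
  refine ⟨clSubmodule M ∅, rfl, fun h => ?_⟩
  obtain ⟨m, hm⟩ := exists_ne (0 : M)
  have : Pi.single ⟨0, hn⟩ (1 : R) ∈ clSubmodule M (∅ : Set (Fin n → R)) :=
    h ▸ Submodule.mem_top
  have := mem_cl.1 this (fun _ => m) (by simp [ann])
  exact hm (by simpa [rowMul_single] using this)

/-- A homomorphism to `M` vanishing on `A` composes with `h` to one vanishing on the preimage. -/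
theorem isCoherent_cl : IsCoherent (R := R) (cl M) := by
  intro m n h A hA
  refine Set.Subset.antisymm (fun x hx => ?_) (isClosureOp_cl.subset _)
  rw [SetLike.mem_coe, Submodule.mem_comap, ← SetLike.mem_coe, ← hA, mem_cl_iff_hom]
  intro f hf
  exact mem_cl_iff_hom.1 hx (f ∘ₗ h) fun s hs => hf _ hs

theorem cl_range_single :
    cl M n (Set.range fun i : Fin n => (Pi.single i 1 : Fin n → R)) = Set.univ := by
  refine Set.eq_univ_of_forall fun x => mem_cl_iff_hom.2 fun f hf => ?_
  rw [← rowMul_apply_single]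
  simp [rowMul, fun i => hf _ ⟨i, rfl⟩]

theorem mem_cl_iff_ann_subset {S : Set (Fin n → R)} {u : Fin n → R} :
    u ∈ cl M n S ↔ ann M S ⊆ ann M (S ∪ {u}) := by
  rw [ann_union, Set.subset_inter_iff]
  exact (and_iff_right subset_rfl).symm

theorem mem_cl_union_iff {S : Set (Fin n → R)} {u t : Fin n → R} :
    u ∈ cl M n (S ∪ {t}) ↔ ann M (S ∪ {t}) ⊆ ann M (S ∪ {u}) := by
  rw [ann_union S {u}, Set.subset_inter_iff]
  exact (and_iff_right (ann_anti Set.subset_union_left)).symm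

theorem ann_chain_iff {S : Set (Fin n → R)} {u t : Fin n → R} :
    (ann M (S ∪ {u}) ⊂ ann M S ∧ ann M (S ∪ {t}) ⊂ ann M (S ∪ {u})) ↔
      u ∉ cl M n S ∧ u ∈ cl M n (S ∪ {t}) ∧ t ∉ cl M n (S ∪ {u}) := by
  rw [ssubset_iff_subset_not_subset, ssubset_iff_subset_not_subset, mem_cl_iff_ann_subset,
    mem_cl_union_iff, mem_cl_union_iff]
  have : ann M (S ∪ {u}) ⊆ ann M S := ann_anti Set.subset_union_left
  tauto

theorem exchange_iff_exchangeBelow :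
    Exchange (cl (R := R) M n) ↔ ExchangeBelow n (cl (R := R) M n) := by
  classical
  refine ⟨fun h => h.exchangeBelow n, fun h => ?_⟩
  refine isClosureOp_cl.exchange_of_exchangeBelow h
    (E := Finset.univ.image fun i : Fin n => (Pi.single i 1 : Fin n → R)) ?_ ?_
  · simpa using Finset.card_image_le (s := Finset.univ)
      (f := fun i : Fin n => (Pi.single i 1 : Fin n → R))
  · simpa using cl_range_single (R := R) (M := M) (n := n)

theorem exchange_iff_noSetChain : Exchange (cl (R := R) M n) ↔ NoSetChain R M n := by
  simp only [Exchange, NoSetChain, ann_chain_iff]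
  push Not
  exact ⟨fun h S u t => h S t u, fun h S t u => h S u t⟩

theorem NoSetChain.noAddColumnChain (h : NoSetChain R M n) : NoAddColumnChain R M n := by
  rintro ⟨m, e, A, B, C, ⟨j, hB⟩, ⟨k, hC⟩, hBA, hCB⟩
  rw [annMatrix, annMatrix, range_col_eq_union e B j, hB] at hBA
  rw [annMatrix, annMatrix, range_col_eq_union e B j, range_col_eq_union e C k, hB, hC] at hCB
  exact h ⟨_, _, _, hBA, hCB⟩

theorem Exchange.noChangeColumnChain (h : Exchange (cl (R := R) M n)) :
    NoChangeColumnChain R M n := by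
  rintro ⟨A, B, C, ⟨j, hj⟩, hBA, hCB⟩
  obtain ⟨m, rfl⟩ : ∃ m, n = m + 1 := ⟨n - 1, by have := j.pos; omega⟩
  have key : ∀ X : Matrix (Fin (m + 1)) (Fin (m + 1)) R, (∀ k, k ≠ j → B.col k = X.col k) →
      annMatrix M X =
        ann M (Set.range (B.submatrix id (Fin.cast rfl ∘ j.succAbove)).col ∪ {X.col j}) := by
    intro X hX
    rw [annMatrix, range_col_eq_union rfl X j]
    congr 3
    ext k i
    exact (congrFun (hX _ (j.succAbove_ne k)) i).symm
  rw [key A fun k hk => (hj k hk).1.symm, key B fun k _ => rfl] at hBA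
  rw [key C fun k hk => (hj k hk).2, key B fun k _ => rfl] at hCB
  set S := Set.range (B.submatrix id (Fin.cast rfl ∘ j.succAbove)).col
  have h1 : A.col j ∈ cl M _ S := by
    by_contra hA
    exact hBA.2 (mem_cl_union_iff.1 (h S (B.col j) (A.col j) hA (mem_cl_union_iff.2 hBA.1)))
  -- Forgetting the changed column of `A` only enlarges its annihilator, so the first inclusion
  -- stays strict.
  refine exchange_iff_noSetChain.1 h ⟨S, B.col j, C.col j, ?_, hCB⟩
  refine ssubset_of_ssubset_of_subset hBA (ann_anti Set.subset_union_left)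

/-- A set of at most `m` columns is, up to zero, the set of columns of a matrix with `m`
columns. -/
theorem exists_matrix_ann_eq {m : ℕ} {S : Set (Fin n → R)} (hS : S.encard ≤ m) :
    ∃ A : Matrix (Fin n) (Fin m) R, ∀ T, ann M (Set.range A.col ∪ T) = ann M (S ∪ T) := by
  classical
  have hfin : S.Finite := Set.finite_of_encard_le_coe hS
  lift S to Finset (Fin n → R) using hfin
  rw [Set.encard_coe_eq_coe_finsetCard, Nat.cast_le] at hS
  -- The default column `0` imposes no condition on rows.
  let g : Fin m → Fin n → R := fun i =>
    if h : (i : ℕ) < S.card then (S.equivFin.symm ⟨i, h⟩ : Fin n → R) else 0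
  refine ⟨fun i k => g k i, fun T => ?_⟩
  rw [ann_union, ann_union]
  congr 1
  change ann M (Set.range g) = _
  refine Set.Subset.antisymm (ann_anti fun s hs => ?_) ?_
  · refine ⟨⟨S.equivFin ⟨s, hs⟩, (Fin.isLt _).trans_le hS⟩, ?_⟩
    simp [g]
  · rw [← ann_insert_zero (S : Set (Fin n → R))]
    refine ann_anti ?_
    rintro _ ⟨i, rfl⟩
    simp only [g]
    split_ifs
    · exact Set.mem_insert_of_mem _ (Subtype.coe_prop _)
    · exact Set.mem_insert _ _

/-- A failure of exchange over a set of fewer than `m + 1` columns is witnessed by matrices. -/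
theorem exchangeBelow_of_forall_matrix {m : ℕ}
    (h : ∀ (A : Matrix (Fin n) (Fin m) R) (u t : Fin n → R),
      ¬ (ann M (Set.range A.col ∪ {u}) ⊂ ann M (Set.range A.col) ∧
        ann M (Set.range A.col ∪ {t}) ⊂ ann M (Set.range A.col ∪ {u}))) :
    ExchangeBelow (m + 1) (cl (R := R) M n) := by
  intro S t u hS hu hut
  obtain ⟨A, hA⟩ := exists_matrix_ann_eq (M := M) (S := S) (m := m) (by
    rw [Nat.cast_add, Nat.cast_one] at hS
    exact (ENat.lt_add_one_iff (ENat.natCast_ne_top m)).1 hS)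
  by_contra ht
  refine h A u t ?_
  have h0 := hA ∅
  rw [Set.union_empty, Set.union_empty] at h0
  rw [hA, hA, h0]
  exact ann_chain_iff.2 ⟨hu, hut, ht⟩

theorem NoAddColumnChain.exchange (h : NoAddColumnChain R M n) :
    Exchange (cl (R := R) M n) := by
  rw [exchange_iff_exchangeBelow]
  rcases n with _ | m
  · intro S t u hS
    simp at hS
  · refine exchangeBelow_of_forall_matrix fun A u t hc => ?_
    refine h ⟨m, rfl, A, consCol u A, consCol t A, ⟨0, rfl⟩, ⟨0, rfl⟩, ?_⟩
    simpa only [annMatrix, range_col_consCol] using hc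

theorem NoChangeColumnChain.exchange (h : NoChangeColumnChain R M n) :
    Exchange (cl (R := R) M n) := by
  rw [exchange_iff_exchangeBelow]
  rcases n with _ | m
  · intro S t u hS
    simp at hS
  · refine exchangeBelow_of_forall_matrix fun A u t hc => ?_
    -- The zero column makes the matrix square without changing its annihilator.
    refine h ⟨consCol 0 A, consCol u A, consCol t A, ⟨0, fun k hk => ?_⟩, ?_⟩
    · obtain ⟨k, rfl⟩ := Fin.exists_succ_eq.2 hk
      exact ⟨rfl, rfl⟩
    · simpa only [annMatrix, range_col_consCol, Set.union_singleton, ann_insert_zero] using hc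

theorem exchange_iff_noAddColumnChain :
    Exchange (cl (R := R) M n) ↔ NoAddColumnChain R M n :=
  ⟨fun h => (exchange_iff_noSetChain.1 h).noAddColumnChain, NoAddColumnChain.exchange⟩

theorem exchange_iff_noChangeColumnChain :
    Exchange (cl (R := R) M n) ↔ NoChangeColumnChain R M n :=
  ⟨Exchange.noChangeColumnChain, NoChangeColumnChain.exchange⟩

end AnnihilatorClosure


/-! ### Pointed modules and their amalgamation -/

section PointedModules

universe u v

variable (A : Type u) [Ring A] (M : Type v) [AddCommGroup M] [Module A M]

/-- The exchange property, for the closure of the empty set in finitely generated modules,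
expressed by homomorphisms into `M`. -/
def HomExchange : Prop :=
  ∀ (P : Type u) [AddCommGroup P] [Module A P] [Module.Finite A P] (p q : P),
    (∃ f : P →ₗ[A] M, f q ≠ 0) → (∀ f : P →ₗ[A] M, f p = 0 → f q = 0) →
      ∀ f : P →ₗ[A] M, f q = 0 → f p = 0

/-- A finitely generated module whose points are separated by homomorphisms into `M`, with a
nonzero point at which these homomorphisms are determined by their values. Such modules play
the role of finitely generated submodules of a division ring that contain `1`. -/
structure IsPointed (P : Type u) [AddCommGroup P] [Module A P] (p : P) : Prop where
  finite : Module.Finite A P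
  separates : ∀ x : P, (∀ f : P →ₗ[A] M, f x = 0) → x = 0
  ne_zero : p ≠ 0
  hom_eq_zero : ∀ f : P →ₗ[A] M, f p = 0 → f = 0

/-- The elements killed by all homomorphisms into `M`. -/
def homKernel (P : Type u) [AddCommGroup P] [Module A P] : Submodule A P :=
  ⨅ f : P →ₗ[A] M, LinearMap.ker f

variable {A M}

section

variable {P Q : Type u} [AddCommGroup P] [Module A P] [AddCommGroup Q] [Module A Q]
  {p : P} {q : Q}

theorem mem_homKernel {x : P} : x ∈ homKernel A M P ↔ ∀ f : P →ₗ[A] M, f x = 0 := by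
  simp [homKernel, Submodule.mem_iInf]

theorem separates_quotient_homKernel (x : P ⧸ homKernel A M P)
    (hx : ∀ f : (P ⧸ homKernel A M P) →ₗ[A] M, f x = 0) : x = 0 := by
  obtain ⟨x, rfl⟩ := Submodule.mkQ_surjective _ x
  rw [Submodule.mkQ_apply, Submodule.Quotient.mk_eq_zero, mem_homKernel]
  intro f
  have hf : homKernel A M P ≤ LinearMap.ker f := fun y hy => mem_homKernel.1 hy f
  simpa using hx ((homKernel A M P).liftQ f hf)

theorem IsPointed.exists_hom_ne_zero (hp : IsPointed A M P p) {x : P} (hx : x ≠ 0) :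
    ∃ f : P →ₗ[A] M, f x ≠ 0 := by
  by_contra! h
  exact hx (hp.separates x h)

theorem IsPointed.of_equiv (hp : IsPointed A M P p) (e : P ≃ₗ[A] Q) :
    IsPointed A M Q (e p) where
  finite := have := hp.finite; Module.Finite.equiv e
  separates x hx := by
    have : e.symm x = 0 := hp.separates _ fun f => by simpa using hx (f ∘ₗ e.symm.toLinearMap)
    simpa using this
  ne_zero := by simpa using hp.ne_zero
  hom_eq_zero f hf := by
    have := hp.hom_eq_zero (f ∘ₗ e.toLinearMap) (by simpa using hf)
    ext x
    simpa using LinearMap.congr_fun this (e.symm x)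

/-- Homomorphisms killing `p` kill `x`, and some homomorphism does not kill `x`; exchange then says
that those killing `x` kill `p`, hence vanish. -/
theorem IsPointed.of_ne_zero (H : HomExchange A M) (hp : IsPointed A M P p) {x : P}
    (hx : x ≠ 0) : IsPointed A M P x where
  finite := hp.finite
  separates := hp.separates
  ne_zero := hx
  hom_eq_zero f hf := by
    have := hp.finite
    refine hp.hom_eq_zero f (H P p x (hp.exists_hom_ne_zero hx) (fun g hg => ?_) f hf)
    rw [hp.hom_eq_zero g hg, LinearMap.zero_apply]

theorem IsPointed.hom_eq_zero_of_map (hp : IsPointed A M P p)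
    (hQ : ∀ x : Q, (∀ f : Q →ₗ[A] M, f x = 0) → x = 0) {g : P →ₗ[A] Q} (hg : g p = 0) :
    g = 0 := by
  ext x
  refine hQ _ fun f => ?_
  exact LinearMap.congr_fun (hp.hom_eq_zero (f ∘ₗ g) (by simp [hg])) x

theorem IsPointed.map_unique (hp : IsPointed A M P p) (hq : IsPointed A M Q q)
    {f g : P →ₗ[A] Q} (h : f p = g p) : f = g :=
  sub_eq_zero.1 (hp.hom_eq_zero_of_map hq.separates (by simp [h]))

/-- A nonzero kernel element would itself serve as a point, forcing `g = 0`. -/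
theorem IsPointed.injective (H : HomExchange A M) (hp : IsPointed A M P p)
    (hq : IsPointed A M Q q) {g : P →ₗ[A] Q} (hg : g p = q) : Function.Injective g := by
  rw [injective_iff_map_eq_zero]
  intro x hx
  by_contra hne
  have := (hp.of_ne_zero H hne).hom_eq_zero_of_map hq.separates hx
  exact hq.ne_zero (by rw [← hg, this, LinearMap.zero_apply])

/-- Two pointed modules map to a common one. -/
theorem IsPointed.exists_amalgam (H : HomExchange A M) (hp : IsPointed A M P p)
    (hq : IsPointed A M Q q) :
    ∃ (W : Type u) (_ : AddCommGroup W) (_ : Module A W) (w : W) (f : P →ₗ[A] W)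
      (g : Q →ₗ[A] W), IsPointed A M W w ∧ f p = w ∧ g q = w := by
  have := hp.finite
  have := hq.finite
  -- Identify `p` with `q`, then divide by `K` to restore separation of points.
  let N : Submodule A (P × Q) := Submodule.span A {(p, -q)}
  let K := homKernel A M ((P × Q) ⧸ N)
  let π : P × Q →ₗ[A] ((P × Q) ⧸ N) ⧸ K := K.mkQ ∘ₗ N.mkQ
  have hπ : π (p, 0) = π (0, q) := by
    have : N.mkQ (p, 0) = N.mkQ (0, q) := by
      rw [← sub_eq_zero, ← map_sub, Submodule.mkQ_apply, Submodule.Quotient.mk_eq_zero]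
      exact Submodule.subset_span (by simp)
    simp only [π, LinearMap.comp_apply, this]
  refine ⟨((P × Q) ⧸ N) ⧸ K, inferInstance, inferInstance, π (p, 0), π ∘ₗ LinearMap.inl A P Q,
    π ∘ₗ LinearMap.inr A P Q, ⟨inferInstance, separates_quotient_homKernel, ?_, ?_⟩, rfl,
    hπ.symm⟩
  -- If the common point vanished, homomorphisms killing `(p, -q)` would kill `(p, 0)`. Exchange
  -- reverses this, but `g` after the second projection kills only the latter.
  · intro h0
    have h1 : ∀ f : P × Q →ₗ[A] M, f (p, -q) = 0 → f (p, 0) = 0 := by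
      intro f hf
      have hN : N ≤ LinearMap.ker f := by
        rw [Submodule.span_le, Set.singleton_subset_iff]
        exact hf
      have h2 : N.mkQ (p, 0) ∈ K := by
        rwa [← Submodule.Quotient.mk_eq_zero]
      simpa using mem_homKernel.1 h2 (N.liftQ f hN)
    obtain ⟨f, hf⟩ := hp.exists_hom_ne_zero hp.ne_zero
    obtain ⟨g, hg⟩ := hq.exists_hom_ne_zero hq.ne_zero
    have := H (P × Q) (p, -q) (p, 0) ⟨f ∘ₗ LinearMap.fst A P Q, hf⟩ h1
      (g ∘ₗ LinearMap.snd A P Q) (by simp)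
    exact hg (by simpa using this)
  · intro f hf
    have h1 := hp.hom_eq_zero (f ∘ₗ π ∘ₗ LinearMap.inl A P Q) hf
    have h2 := hq.hom_eq_zero (f ∘ₗ π ∘ₗ LinearMap.inr A P Q) (by
      change f (π (0, q)) = 0
      rw [← hπ, hf])
    have hπs : Function.Surjective π :=
      (Submodule.mkQ_surjective K).comp (Submodule.mkQ_surjective N)
    rw [← LinearMap.cancel_right hπs]
    exact LinearMap.prod_ext h1 h2

end

/-! ### The directed system of pointed modules and its limit -/

variable (A M) in
/-- The pointed modules presented as quotients of the modules `A^n`. -/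
structure PointedModule where
  rank : ℕ
  relations : Submodule A (Fin rank → A)
  point : (Fin rank → A) ⧸ relations
  isPointed : IsPointed A M ((Fin rank → A) ⧸ relations) point

namespace PointedModule

/-- The module underlying a presented pointed module. -/
abbrev Carrier (i : PointedModule A M) : Type u := (Fin i.rank → A) ⧸ i.relations

theorem exists_equiv {P : Type u} [AddCommGroup P] [Module A P] {p : P}
    (hp : IsPointed A M P p) :
    ∃ (i : PointedModule A M) (e : P ≃ₗ[A] i.Carrier), e p = i.point := by
  have := hp.finite
  obtain ⟨n, f, hf⟩ := Module.Finite.exists_fin' A P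
  let e := (f.quotKerEquivOfSurjective hf).symm
  exact ⟨⟨n, LinearMap.ker f, e p, hp.of_equiv e⟩, e, rfl⟩

instance : Preorder (PointedModule A M) where
  le i j := ∃ f : i.Carrier →ₗ[A] j.Carrier, f i.point = j.point
  le_refl i := ⟨LinearMap.id, rfl⟩
  le_trans i j k := by
    rintro ⟨f, hf⟩ ⟨g, hg⟩
    exact ⟨g ∘ₗ f, by simp [hf, hg]⟩

/-- The unique pointed homomorphism between comparable pointed modules. -/
noncomputable def map (i j : PointedModule A M) (h : i ≤ j) : i.Carrier →ₗ[A] j.Carrier :=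
  h.choose

theorem map_point {i j : PointedModule A M} (h : i ≤ j) : map i j h i.point = j.point :=
  h.choose_spec

theorem eq_map {i j : PointedModule A M} (h : i ≤ j) {f : i.Carrier →ₗ[A] j.Carrier}
    (hf : f i.point = j.point) : f = map i j h :=
  i.isPointed.map_unique j.isPointed (hf.trans (map_point h).symm)

theorem map_map {i j k : PointedModule A M} (hij : i ≤ j) (hjk : j ≤ k) (x : i.Carrier) :
    map j k hjk (map i j hij x) = map i k (hij.trans hjk) x :=
  LinearMap.congr_fun (eq_map (f := map j k hjk ∘ₗ map i j hij) (hij.trans hjk)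
    (by simp [map_point])) x

instance : DirectedSystem (fun i : PointedModule A M => i.Carrier) (map · · ·) where
  map_self i x := LinearMap.congr_fun (eq_map (f := LinearMap.id) (le_refl i) rfl).symm x
  map_map _ _ _ hij hjk x := map_map hij hjk x

theorem isDirectedOrder (H : HomExchange A M) : IsDirectedOrder (PointedModule A M) where
  directed i j := by
    obtain ⟨W, _, _, w, f, g, hw, hf, hg⟩ := i.isPointed.exists_amalgam H j.isPointed
    obtain ⟨k, e, he⟩ := exists_equiv hw
    exact ⟨k, ⟨e.toLinearMap ∘ₗ f, by simp [hf, he]⟩, ⟨e.toLinearMap ∘ₗ g, by simp [hg, he]⟩⟩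

end PointedModule

open PointedModule

noncomputable instance : DecidableEq (PointedModule A M) := Classical.decEq _

variable (A M) in
/-- The direct limit of all pointed modules. -/
def PointedLimit : Type u :=
  Module.DirectLimit (fun i : PointedModule A M => i.Carrier) map

namespace PointedLimit

noncomputable instance : AddCommGroup (PointedLimit A M) :=
  Module.DirectLimit.addCommGroup (fun i : PointedModule A M => i.Carrier) map

noncomputable instance : Module A (PointedLimit A M) :=
  Module.DirectLimit.module (fun i : PointedModule A M => i.Carrier) map

/-- The canonical map from a pointed module to the direct limit. -/
noncomputable def of (i : PointedModule A M) : i.Carrier →ₗ[A] PointedLimit A M :=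
  Module.DirectLimit.of A _ _ map i

theorem exists_of (H : HomExchange A M) [Nonempty (PointedModule A M)]
    (d : PointedLimit A M) : ∃ (i : PointedModule A M) (x : i.Carrier), of i x = d :=
  have := isDirectedOrder H
  Module.DirectLimit.exists_of d

theorem exists_lift {D : Type*} [AddCommGroup D] [Module A D]
    (g : ∀ i : PointedModule A M, i.Carrier →ₗ[A] D)
    (hg : ∀ i j hij x, g j (map i j hij x) = g i x) :
    ∃ φ : PointedLimit A M →ₗ[A] D,
      ∀ (i : PointedModule A M) (x : i.Carrier), φ (of i x) = g i x :=
  ⟨Module.DirectLimit.lift A _ _ _ g hg, fun _ => Module.DirectLimit.lift_of g hg⟩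

theorem of_map {i j : PointedModule A M} (h : i ≤ j) (x : i.Carrier) :
    of j (map i j h x) = of i x :=
  Module.DirectLimit.of_f

theorem of_injective (H : HomExchange A M) (i : PointedModule A M) :
    Function.Injective (of i) := by
  have := isDirectedOrder H
  rw [injective_iff_map_eq_zero]
  intro x hx
  obtain ⟨j, hij, hj⟩ := Module.DirectLimit.of.zero_exact hx
  exact (injective_iff_map_eq_zero _).1
    (i.isPointed.injective H j.isPointed (map_point hij)) x hj

theorem of_point_eq (H : HomExchange A M) (i j : PointedModule A M) :
    of i i.point = of j j.point := by
  obtain ⟨k, hik, hjk⟩ := (isDirectedOrder H).directed i j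
  rw [← of_map hik, ← of_map hjk, map_point, map_point]

/-- A finitely generated submodule of the direct limit lies in a stage of the system. -/
theorem exists_range_le (H : HomExchange A M) [Nonempty (PointedModule A M)]
    {N : Submodule A (PointedLimit A M)} (hN : N.FG) :
    ∃ j : PointedModule A M, N ≤ LinearMap.range (of j) := by
  have := isDirectedOrder H
  induction N, hN using Submodule.fg_induction with
  | singleton x =>
    obtain ⟨i, y, rfl⟩ := exists_of H x
    exact ⟨i, by simp [Submodule.span_singleton_le_iff_mem]⟩
  | sup N₁ N₂ _ _ h₁ h₂ =>
    obtain ⟨i, hi⟩ := h₁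
    obtain ⟨j, hj⟩ := h₂
    obtain ⟨k, hik, hjk⟩ := exists_ge_ge i j
    refine ⟨k, sup_le (hi.trans ?_) (hj.trans ?_)⟩
    · rintro _ ⟨x, rfl⟩
      exact ⟨_, of_map hik x⟩
    · rintro _ ⟨x, rfl⟩
      exact ⟨_, of_map hjk x⟩

/-- The image of a stage is finitely generated, so it lies in another stage; this gives a map of
stages killing the point. -/
theorem hom_eq_zero (H : HomExchange A M) {i : PointedModule A M}
    {φ : PointedLimit A M →ₗ[A] PointedLimit A M} (hφ : φ (of i i.point) = 0) : φ = 0 := by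
  have : Nonempty (PointedModule A M) := ⟨i⟩
  suffices h : ∀ (k : PointedModule A M) x, φ (of k x) = 0 by
    ext d
    obtain ⟨k, x, rfl⟩ := exists_of H d
    exact h k x
  intro k x
  have := k.isPointed.finite
  obtain ⟨j, hj⟩ := exists_range_le H (N := LinearMap.range (φ ∘ₗ of k))
    (Module.Finite.iff_fg.1 inferInstance)
  let e := LinearEquiv.ofInjective (of j) (of_injective H j)
  let g : k.Carrier →ₗ[A] j.Carrier :=
    e.symm.toLinearMap ∘ₗ (φ ∘ₗ of k).codRestrict _ fun x => hj ⟨x, rfl⟩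
  have hg : ∀ x, of j (g x) = φ (of k x) := fun x =>
    congrArg Subtype.val (e.apply_symm_apply ⟨φ (of k x), hj ⟨x, rfl⟩⟩)
  have h0 : g = 0 := by
    refine k.isPointed.hom_eq_zero_of_map j.isPointed.separates (of_injective H j ?_)
    rw [hg, of_point_eq H k i, hφ, map_zero]
  rw [← hg, h0, LinearMap.zero_apply, map_zero]

/-- Every nonzero element of the direct limit is mapped to the point by an endomorphism. -/
theorem exists_hom_eq_point (H : HomExchange A M) {i : PointedModule A M}
    {d : PointedLimit A M} (hd : d ≠ 0) :
    ∃ φ : PointedLimit A M →ₗ[A] PointedLimit A M, φ d = of i i.point := by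
  have := isDirectedOrder H
  have : Nonempty (PointedModule A M) := ⟨i⟩
  obtain ⟨l, q, rfl⟩ := exists_of H d
  have hq : q ≠ 0 := fun h => hd (by rw [h, map_zero])
  -- Each stage above `l` is re-pointed at the image of `q`; `r k` presents the result.
  have hrep : ∀ k : PointedModule A M, ∀ hlk : l ≤ k,
      IsPointed A M k.Carrier (map l k hlk q) := fun k hlk =>
    k.isPointed.of_ne_zero H fun h => hq <|
      (injective_iff_map_eq_zero _).1 (l.isPointed.injective H k.isPointed (map_point hlk)) q h
  choose r e he using fun k hlk => exists_equiv (hrep k hlk)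
  have hcompat : ∀ (j k : PointedModule A M) (hlj : l ≤ j) (hjk : j ≤ k) (x : j.Carrier),
      of (r k (hlj.trans hjk)) (e k (hlj.trans hjk) (map j k hjk x)) =
        of (r j hlj) (e j hlj x) := by
    intro j k hlj hjk x
    let f := (e k (hlj.trans hjk)).toLinearMap ∘ₗ map j k hjk ∘ₗ (e j hlj).symm.toLinearMap
    have hf : f (r j hlj).point = (r k (hlj.trans hjk)).point := by
      simp [f, ← he, map_map]
    have hle : r j hlj ≤ r k (hlj.trans hjk) := ⟨f, hf⟩
    rw [← of_map hle, ← eq_map hle hf]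
    simp [f]
  -- A stage need not lie above `l`, so it is first mapped to a common bound; `hg` shows that the
  -- choice is immaterial.
  choose u hu hlu using fun k => exists_ge_ge k l
  let g : ∀ k : PointedModule A M, k.Carrier →ₗ[A] PointedLimit A M := fun k =>
    of (r (u k) (hlu k)) ∘ₗ (e (u k) (hlu k)).toLinearMap ∘ₗ map k (u k) (hu k)
  have hg : ∀ (k m : PointedModule A M) (hkm : k ≤ m) (hlm : l ≤ m) (x : k.Carrier),
      g k x = of (r m hlm) (e m hlm (map k m hkm x)) := by
    intro k m hkm hlm x
    obtain ⟨n, hun, hmn⟩ := exists_ge_ge (u k) m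
    have h1 := hcompat (u k) n (hlu k) hun (map k (u k) (hu k) x)
    have h2 := hcompat m n hlm hmn (map k m hkm x)
    rw [map_map] at h1 h2
    exact h1.symm.trans h2
  obtain ⟨φ, hφ⟩ := exists_lift g fun j k hjk x => by
    rw [hg j (u k) (hjk.trans (hu k)) (hlu k), hg k (u k) (hu k) (hlu k), map_map]
  exact ⟨φ, by rw [hφ, hg l l le_rfl le_rfl, he, of_point_eq H]⟩

/-- A nonzero endomorphism moves the point to a nonzero element, which another endomorphism carries
back. This gives left inverses to all nonzero elements, and these are then two-sided. -/
theorem isUnit_end (H : HomExchange A M) (i : PointedModule A M)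
    (φ : Module.End A (PointedLimit A M)) : IsUnit φ ∨ φ = 0 := by
  rw [or_iff_not_imp_right]
  have left_inverse : ∀ φ : Module.End A (PointedLimit A M), φ ≠ 0 → ∃ ψ, ψ * φ = 1 := by
    intro φ hφ
    obtain ⟨ψ, hψ⟩ := exists_hom_eq_point H (i := i) (d := φ (of i i.point))
      fun h => hφ (hom_eq_zero H h)
    refine ⟨ψ, sub_eq_zero.1 (hom_eq_zero H (i := i) ?_)⟩
    simp [hψ]
  intro hφ
  obtain ⟨ψ, hψ⟩ := left_inverse φ hφ
  obtain ⟨χ, hχ⟩ := left_inverse ψ fun h => hφ <| by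
    rw [← one_mul φ, ← mul_one (1 : Module.End A (PointedLimit A M)), ← hψ, h]
    simp
  have : χ = φ := by rw [← mul_one χ, ← hψ, ← mul_assoc, hχ, one_mul]
  exact ⟨⟨φ, ψ, this ▸ hχ, hψ⟩, rfl⟩

theorem exists_hom_of_point (H : HomExchange A M) (i : PointedModule A M)
    (d : PointedLimit A M) :
    ∃ φ : Module.End A (PointedLimit A M), φ (of i i.point) = d := by
  by_cases hd : d = 0
  · exact ⟨0, by simp [hd]⟩
  obtain ⟨ψ, hψ⟩ := exists_hom_eq_point H (i := i) hd
  rcases isUnit_end H i ψ with ⟨v, rfl⟩ | rfl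
  · refine ⟨(v⁻¹ : (Module.End A (PointedLimit A M))ˣ), ?_⟩
    rw [← hψ, ← Module.End.mul_apply, Units.inv_mul, Module.End.one_apply]
  · exact absurd hψ.symm (fun h => i.isPointed.ne_zero (of_injective H i (by simpa using h)))

end PointedLimit

theorem isPointed_self [Nontrivial M] [FaithfulSMul A M] : IsPointed A M A 1 where
  finite := inferInstance
  separates x hx := by
    refine FaithfulSMul.eq_of_smul_eq_smul (α := M) fun m => ?_
    simpa using hx (LinearMap.toSpanSingleton A M m)
  ne_zero h := by
    obtain ⟨m, hm⟩ := exists_ne (0 : M)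
    exact hm (by rw [← one_smul A m, h, zero_smul])
  hom_eq_zero f hf := LinearMap.ext_ring hf

end PointedModules

/-! ### The embedding into a division ring -/

theorem homExchange_of_exchange.{u, v} {R : Type u} [Ring R] {M : Type v} [AddCommGroup M]
    [Module Rᵐᵒᵖ M] (h : ∀ n, Exchange (cl (R := R) M n)) : HomExchange Rᵐᵒᵖ M := by
  intro P _ _ _ p q ⟨f₀, hf₀⟩ hpq f hfq
  obtain ⟨n, π', hπ'⟩ := Module.Finite.exists_fin' Rᵐᵒᵖ P
  let π : (Fin n → R) →ₗ[Rᵐᵒᵖ] P :=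
    π' ∘ₗ (LinearEquiv.piCongrRight fun _ => MulOpposite.opLinearEquiv Rᵐᵒᵖ).toLinearMap
  have hπ : Function.Surjective π := hπ'.comp (LinearEquiv.surjective _)
  obtain ⟨t, rfl⟩ := hπ p
  obtain ⟨u, rfl⟩ := hπ q
  have factor : ∀ g : (Fin n → R) →ₗ[Rᵐᵒᵖ] M, LinearMap.ker π ≤ LinearMap.ker g →
      ∃ g' : P →ₗ[Rᵐᵒᵖ] M, ∀ x, g' (π x) = g x := by
    intro g hg
    refine ⟨(LinearMap.ker π).liftQ g hg ∘ₗ (π.quotKerEquivOfSurjective hπ).symm.toLinearMap,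
      fun x => ?_⟩
    have : (π.quotKerEquivOfSurjective hπ).symm (π x) = (LinearMap.ker π).mkQ x := by
      rw [LinearEquiv.symm_apply_eq]
      rfl
    rw [LinearMap.comp_apply, LinearEquiv.coe_coe, this, Submodule.mkQ_apply,
      Submodule.liftQ_apply]
  -- Homomorphisms `P → M` are those on `R^n` killing `ker π`, so exchange in `P` is exchange over
  -- this kernel.
  have key := h n (LinearMap.ker π) t u ?_ ?_
  · refine mem_cl_iff_hom.1 key (f ∘ₗ π) ?_
    rintro s (hs | rfl)
    · simp [LinearMap.mem_ker.1 hs]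
    · exact hfq
  · intro hu
    exact hf₀ (mem_cl_iff_hom.1 hu (f₀ ∘ₗ π) fun s hs => by simp [LinearMap.mem_ker.1 hs])
  · refine mem_cl_iff_hom.2 fun g hg => ?_
    obtain ⟨g', hg'⟩ := factor g fun s hs => hg s (Or.inl hs)
    rw [← hg']
    exact hpq g' (by rw [hg']; exact hg t (Or.inr rfl))

theorem embedsInDivisionRing_of_homExchange.{u, v} {R : Type u} [Ring R] {M : Type v}
    [AddCommGroup M] [Module Rᵐᵒᵖ M] [Nontrivial M] [FaithfulSMul Rᵐᵒᵖ M]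
    (H : HomExchange Rᵐᵒᵖ M) : EmbedsInDivisionRing R := by
  obtain ⟨i, e, he⟩ := PointedModule.exists_equiv (isPointed_self (A := Rᵐᵒᵖ) (M := M))
  have heq : ∀ φ ψ : Module.End Rᵐᵒᵖ (PointedLimit Rᵐᵒᵖ M),
      φ (.of i i.point) = ψ (.of i i.point) → φ = ψ := fun φ ψ h =>
    sub_eq_zero.1 (PointedLimit.hom_eq_zero H (i := i) (by simp [h]))
  have hinj : ∀ a : Rᵐᵒᵖ, a • PointedLimit.of i i.point = 0 → a = 0 := by
    intro a ha
    rw [← he, ← map_smul, ← map_smul, smul_eq_mul, mul_one] at ha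
    exact e.injective (PointedLimit.of_injective H i (by simpa using ha))
  have : Nontrivial (Module.End Rᵐᵒᵖ (PointedLimit Rᵐᵒᵖ M)) := by
    refine ⟨1, 0, fun h => i.isPointed.ne_zero (PointedLimit.of_injective H i ?_)⟩
    simpa using LinearMap.congr_fun h (PointedLimit.of i i.point)
  choose φ hφ using fun r : R =>
    PointedLimit.exists_hom_of_point H i (MulOpposite.op r • PointedLimit.of i i.point)
  -- Endomorphisms commute with the right action, so `φ r` after `φ s` sends the point to its
  -- multiple by `r`, then by `s`: the order of `R`, not of its opposite.
  let F : R →+* Module.End Rᵐᵒᵖ (PointedLimit Rᵐᵒᵖ M) :=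
    { toFun := φ
      map_one' := heq _ _ (by simp [hφ])
      map_zero' := heq _ _ (by simp [hφ])
      map_mul' := fun r s => heq _ _ (by
        rw [Module.End.mul_apply, hφ, hφ, map_smul, hφ, smul_smul, MulOpposite.op_mul])
      map_add' := fun r s => heq _ _ (by
        rw [LinearMap.add_apply, hφ, hφ, hφ, MulOpposite.op_add, add_smul]) }
  refine ⟨_, DivisionRing.ofIsUnitOrEqZero (PointedLimit.isUnit_end H i), F, ?_⟩
  refine (injective_iff_map_eq_zero F).2 fun r hr => ?_
  have : MulOpposite.op r • PointedLimit.of i i.point = 0 := by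
    rw [← hφ]
    exact LinearMap.congr_fun hr _
  simpa using hinj _ this

end ModuleClosure

theorem lemmaL {R : Type*} [Ring R] {M : Type*} [AddCommGroup M] [Module Rᵐᵒᵖ M]
    [Nontrivial M] :
    (∀ n : ℕ, ModuleClosure.IsSubmoduleClosure (R := R) (ModuleClosure.cl M n)) ∧
    ModuleClosure.IsProper (R := R) (ModuleClosure.cl M) ∧
    ModuleClosure.IsCoherent (R := R) (ModuleClosure.cl M) ∧
    (∀ n : ℕ,
      (ModuleClosure.Exchange (ModuleClosure.cl (R := R) M n) ↔
        ModuleClosure.ExchangeBelow n (ModuleClosure.cl (R := R) M n)) ∧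
      (ModuleClosure.Exchange (ModuleClosure.cl (R := R) M n) ↔
        ModuleClosure.NoSetChain R M n) ∧
      (ModuleClosure.Exchange (ModuleClosure.cl (R := R) M n) ↔
        ModuleClosure.NoAddColumnChain R M n) ∧
      (ModuleClosure.Exchange (ModuleClosure.cl (R := R) M n) ↔
        ModuleClosure.NoChangeColumnChain R M n)) ∧
    (FaithfulSMul Rᵐᵒᵖ M →
      ((∀ n : ℕ, ModuleClosure.NoSetChain R M n) ∨
        (∀ n : ℕ, ModuleClosure.NoAddColumnChain R M n) ∨
        (∀ n : ℕ, ModuleClosure.NoChangeColumnChain R M n)) →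
      ModuleClosure.EmbedsInDivisionRing R) := by
  open ModuleClosure in
  refine ⟨fun n => isSubmoduleClosure_cl, isProper_cl, isCoherent_cl,
    fun n => ⟨exchange_iff_exchangeBelow, exchange_iff_noSetChain,
      exchange_iff_noAddColumnChain, exchange_iff_noChangeColumnChain⟩, fun _ h => ?_⟩
  refine ModuleClosure.embedsInDivisionRing_of_homExchange (M := M)
    (ModuleClosure.homExchange_of_exchange fun n => ?_)
  rcases h with h | h | h
  · exact ModuleClosure.exchange_iff_noSetChain.2 (h n)
  · exact (h n).exchange
  · exact (h n).exchange
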